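/- For an integer $k\ge 2$, let $\mathcal H_k$ be the class of all finite $k$-uniform hypergraphs without multiple edges, isolated vertices or isolated edges (an isolated edge is one that intersects no other edge). A total transversal of a hypergraph $H$ is a set $T$ of vertices of $H$ that meets every edge of $H$ and such that every vertex of $T$ lies in a common edge with some other vertex of $T$; let $\tau_t(H)$ be the minimum size of a total transversal of $H$. Let $n_H$ and $m_H$ be the numbers of vertices and edges of $H$, and let $$b_k=\sup_{H\in\mathcal H_k}\frac{\tau_t(H)}{n_H+m_H},$$ the supremum being over the $H$ with at least one vertex. Then, as $k\to\infty$, $$b_k=(1+o(1))\,\frac{\ln k}{k}.$$ -/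

import Mathlib

namespace Hypergraph

/-- `T` is a transversal of `H`: a set of vertices of `H` that meets every edge of `H`. -/
def IsTransversal {α : Type*} (H : Hypergraph α) (T : Set α) : Prop :=
  T ⊆ H.vertexSet ∧ ∀ e ∈ H.edgeSet, (e ∩ T).Nonempty

/-- `T` is a total transversal of `H`: a transversal in which every vertex has a neighbor,
that is, a vertex different from it that lies in a common edge with it. -/
def IsTotalTransversal {α : Type*} (H : Hypergraph α) (T : Set α) : Prop :=
  H.IsTransversal T ∧ ∀ x ∈ T, ∃ y ∈ T, y ≠ x ∧ H.Adj x y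

/-- The total transversal number of `H`: the minimum size of a total transversal of `H`
(a minimum over a nonempty set on the class `IsInClass k` below for `k ≥ 2`,
see `IsInClass.isTotalTransversal_vertexSet`). -/
noncomputable def totalTransversalNumber {α : Type*} (H : Hypergraph α) : ℕ :=
  sInf {t : ℕ | ∃ T : Set α, H.IsTotalTransversal T ∧ T.ncard = t}

/-- The class of all finite `k`-uniform hypergraphs without isolated vertices and without isolated
edges (edges that meet no other edge). The edges form a set of sets, so there are no multiple
edges. -/
structure IsInClass {α : Type*} (k : ℕ) (H : Hypergraph α) : Prop where
  finite_vertexSet : H.vertexSet.Finite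
  uniform : ∀ e ∈ H.edgeSet, e.ncard = k
  no_isolated_vertex : ∀ x ∈ H.vertexSet, ¬ H.IsIsolated x
  no_isolated_edge : ∀ e ∈ H.edgeSet, ∃ f ∈ H.edgeSet, f ≠ e ∧ (e ∩ f).Nonempty

/-- The set of all ratios `τ_t(H) / (n_H + m_H)`, over the hypergraphs `H` of the class with at
least one vertex. -/
def totalTransversalRatios (k : ℕ) : Set ℝ :=
  {r : ℝ | ∃ (α : Type) (H : Hypergraph α), H.IsInClass k ∧ H.vertexSet.Nonempty ∧
    r = (H.totalTransversalNumber : ℝ) /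
      ((H.vertexSet.ncard : ℝ) + (H.edgeSet.ncard : ℝ))}

/-- The constant `b_k`: the supremum of the ratios `τ_t(H) / (n_H + m_H)`. For `k ≥ 2` this is a
true least upper bound, see `isLUB_totalTransversalConst`. -/
noncomputable def totalTransversalConst (k : ℕ) : ℝ :=
  sSup (totalTransversalRatios k)

theorem IsInClass.isTotalTransversal_vertexSet {α : Type*} {k : ℕ} {H : Hypergraph α}
    (hk : 2 ≤ k) (h : H.IsInClass k) : H.IsTotalTransversal H.vertexSet := by
  refine ⟨⟨subset_rfl, fun e he => ?_⟩, fun x hx => ?_⟩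
  · have hs := H.subset_vertexSet_of_mem_edgeSet' he
    rw [Set.inter_eq_left.2 hs]
    apply Set.nonempty_of_ncard_ne_zero
    have := h.uniform e he
    omega
  · have hi := h.no_isolated_vertex x hx
    simp only [IsIsolated, not_forall, not_not] at hi
    obtain ⟨e, he, hxe⟩ := hi
    obtain ⟨y, hy, hyx⟩ :=
      Set.exists_ne_of_one_lt_ncard (s := e) (by have := h.uniform e he; omega) x
    exact ⟨y, H.subset_vertexSet_of_mem_edgeSet' he hy, hyx, e, he, hxe, hy⟩

theorem nonempty_totalTransversalRatios {k : ℕ} (hk : 2 ≤ k) :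
    (totalTransversalRatios k).Nonempty := by
  have h0l : (0 : Fin (k + 1)) ≠ Fin.last k := by
    intro h
    have := congrArg Fin.val h
    simp at this
    omega
  have hcard : ∀ a : Fin (k + 1), ({a}ᶜ : Set (Fin (k + 1))).ncard = k := by
    intro a
    rw [Set.ncard_compl]
    simp
  have hne : ({0}ᶜ : Set (Fin (k + 1))) ≠ {Fin.last k}ᶜ := by
    intro h
    exact h0l (Set.singleton_injective (compl_injective h))
  have hint : (({0}ᶜ : Set (Fin (k + 1))) ∩ {Fin.last k}ᶜ).Nonempty := by
    refine ⟨⟨1, by omega⟩, ?_, ?_⟩ <;> simp [Fin.ext_iff] <;> omega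
  refine ⟨_, Fin (k + 1), ⟨Set.univ, {{0}ᶜ, {Fin.last k}ᶜ}, fun _ _ => Set.subset_univ _⟩,
    ⟨Set.finite_univ, ?_, ?_, ?_⟩, ⟨0, Set.mem_univ _⟩, rfl⟩
  · rintro e (rfl | rfl) <;> exact hcard _
  · intro x _ hx
    by_cases h : x = 0
    · exact hx {Fin.last k}ᶜ (Or.inr rfl) (by simpa [h] using h0l)
    · exact hx {0}ᶜ (Or.inl rfl) (by simpa using h)
  · rintro e (rfl | rfl)
    · exact ⟨_, Or.inr rfl, hne.symm, hint⟩
    · exact ⟨_, Or.inl rfl, hne, by rwa [Set.inter_comm]⟩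

theorem bddAbove_totalTransversalRatios {k : ℕ} (hk : 2 ≤ k) :
    BddAbove (totalTransversalRatios k) := by
  refine ⟨1, ?_⟩
  rintro r ⟨α, H, h, -, rfl⟩
  have h1 : H.totalTransversalNumber ≤ H.vertexSet.ncard :=
    Nat.sInf_le ⟨_, h.isTotalTransversal_vertexSet hk, rfl⟩
  have h2 : (H.totalTransversalNumber : ℝ) ≤ H.vertexSet.ncard := by exact_mod_cast h1
  refine div_le_one_of_le₀ ?_ (by positivity)
  have : (0 : ℝ) ≤ H.edgeSet.ncard := by positivity
  linarith

theorem isLUB_totalTransversalConst {k : ℕ} (hk : 2 ≤ k) :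
    IsLUB (totalTransversalRatios k) (totalTransversalConst k) :=
  isLUB_csSup (nonempty_totalTransversalRatios hk) (bddAbove_totalTransversalRatios hk)

end Hypergraph

/-!
The upper and the lower bound on `b_k` are both probabilistic, and both are derandomized below.

*Upper bound.* Pick each vertex independently with probability `p = log k / ((1 - δ) * k)`, and then
add two vertices of every edge that was met at most once. Now every edge is met at least twice, so
the set is a transversal, and as each of its vertices lies in some edge, it is even a total
transversal. The probability that an edge is met at most once is, since `δ ^ j / δ ≥ 1` for `j ≤ 1`,
at most `(1 - p + p * δ) ^ k / δ ≤ 1 / (δ * k)`. So the expected size is at most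
`p * n + 2 / (δ * k) * m`, and `2 / (δ * k) ≤ p` for large `k`, for each fixed `δ`. The random set is
replaced by the method of conditional expectations in `exists_subset_card_add_sum_mul_pow_le`.

*Lower bound.* Take `k` random `k`-subsets of a set of `n ≈ k * log k` vertices. A set of
`t ≈ (1 - ε) * (log k) ^ 2` vertices misses a given one of them with probability at least
`k ^ (-(1 - ε / 2))`, so it meets all of them with probability at most `exp (-k ^ (ε / 2))`, which
is far below `n ^ (-t)`. Hence some choice has no transversal of size `t`
(`exists_family_forall_lt_card_of_meets`, with a greedy choice instead of a random one).
Adding to each edge a companion that meets it removes isolated edges, and dropping the uncovered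
vertices removes isolated vertices; `n + m` remains `(1 + o(1)) * k * log k`.
-/

open Filter Topology Finset

/-! ### Upper bound: random sets of vertices -/

/-- Method of conditional expectations: if `S` is a random subset of `V` containing each vertex
independently with probability `p`, the right-hand side is the expectation of the left-hand side,
so some `S` does not exceed it. The weights `c` vary in the induction over the vertices. -/
theorem exists_subset_card_add_sum_mul_pow_le {α ι : Type*} [DecidableEq α] (V : Finset α)
    (F : Finset ι) (A : ι → Finset α) {p δ : ℝ} (hp0 : 0 ≤ p) (hp1 : p ≤ 1) (c : ι → ℝ) :
    ∃ S ⊆ V, (#S : ℝ) + ∑ i ∈ F, c i * δ ^ #(A i ∩ S) ≤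
      p * #V + ∑ i ∈ F, c i * (1 - p + p * δ) ^ #(A i ∩ V) := by
  induction V using Finset.induction_on generalizing c with
  | empty => exact ⟨∅, subset_rfl, by simp⟩
  | insert v V hv ih =>
    obtain ⟨S, hSV, hS⟩ := ih fun i => if v ∈ A i then c i * (1 - p + p * δ) else c i
    have hvS : v ∉ S := fun h => hv (hSV h)
    have hins : ∀ (U : Finset α), v ∉ U → ∀ i (x : ℝ), x ^ #(A i ∩ insert v U) =
        (if v ∈ A i then x else 1) * x ^ #(A i ∩ U) := by
      intro U hU i x
      split_ifs with h
      · rw [inter_insert_of_mem h, card_insert_of_notMem (by simp [hU]), pow_succ']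
      · rw [inter_insert_of_notMem h, one_mul]
    have hV : ∑ i ∈ F, (if v ∈ A i then c i * (1 - p + p * δ) else c i) *
        (1 - p + p * δ) ^ #(A i ∩ V) =
        ∑ i ∈ F, c i * (1 - p + p * δ) ^ #(A i ∩ insert v V) := by
      refine sum_congr rfl fun i _ => ?_
      rw [hins V hv]
      split_ifs <;> ring
    -- The bound for `S` is the average of the potentials of `insert v S` and of `S`.
    have havg : p * (∑ i ∈ F, c i * δ ^ #(A i ∩ insert v S)) +
        (1 - p) * ∑ i ∈ F, c i * δ ^ #(A i ∩ S) =
        ∑ i ∈ F, (if v ∈ A i then c i * (1 - p + p * δ) else c i) * δ ^ #(A i ∩ S) := by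
      rw [mul_sum, mul_sum, ← sum_add_distrib]
      refine sum_congr rfl fun i _ => ?_
      rw [hins S hvS]
      split_ifs <;> ring
    rw [hV, ← havg] at hS
    rw [card_insert_of_notMem hv]
    push_cast
    by_contra! hcon
    have h1 := hcon (insert v S) (insert_subset_insert v hSV)
    have h2 := hcon S (hSV.trans (subset_insert v V))
    rw [card_insert_of_notMem hvS] at h1
    push_cast at h1
    rcases hp0.eq_or_lt with rfl | hp
    · linarith
    · nlinarith [mul_lt_mul_of_pos_left h1 hp,
        mul_le_mul_of_nonneg_left h2.le (sub_nonneg.2 hp1)]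

/-- A set becomes one that meets every `A i` twice after adding two elements of each `A i` that it
meets at most once. -/
theorem exists_superset_two_le_card_inter {α ι : Type*} [DecidableEq α] {V : Finset α}
    {F : Finset ι} {A : ι → Finset α} (hAV : ∀ i ∈ F, A i ⊆ V) (hA : ∀ i ∈ F, 2 ≤ #(A i))
    {S : Finset α} (hS : S ⊆ V) :
    ∃ T ⊆ V, (∀ i ∈ F, 2 ≤ #(A i ∩ T)) ∧
      #T ≤ #S + 2 * #{i ∈ F | #(A i ∩ S) ≤ 1} := by
  choose! P hPA hP using fun i (hi : i ∈ F) => exists_subset_card_eq (hA i hi)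
  refine ⟨S ∪ ({i ∈ F | #(A i ∩ S) ≤ 1}).biUnion P, ?_, fun i hi => ?_, ?_⟩
  · refine union_subset hS (biUnion_subset.2 fun i hi => ?_)
    have hi := (mem_filter.1 hi).1
    exact (hPA i hi).trans (hAV i hi)
  · by_cases h : #(A i ∩ S) ≤ 1
    · rw [← hP i hi]
      refine card_le_card (subset_inter (hPA i hi) (subset_union_right.trans' ?_))
      exact subset_biUnion_of_mem P (mem_filter.2 ⟨hi, h⟩)
    · exact (not_le.1 h).trans_le
        (card_le_card (inter_subset_inter_left subset_union_left))
  · refine (card_union_le _ _).trans (Nat.add_le_add_left ?_ _)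
    rw [mul_comm]
    exact card_biUnion_le_card_mul _ _ _ fun i hi => (hP i (mem_filter.1 hi).1).le

namespace Hypergraph

theorem IsInClass.totalTransversalNumber_le {α : Type*} {k : ℕ} {H : Hypergraph α}
    (h : H.IsInClass k) (hk : 2 ≤ k) {p δ : ℝ} (hp0 : 0 ≤ p) (hp1 : p ≤ 1) (hδ0 : 0 < δ)
    (hδ1 : δ ≤ 1) :
    (H.totalTransversalNumber : ℝ) ≤
      p * H.vertexSet.ncard + 2 / δ * (1 - p + p * δ) ^ k * H.edgeSet.ncard := by
  classical
  have hE : H.edgeSet.Finite := h.finite_vertexSet.finite_subsets.subset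
    fun e he => H.subset_vertexSet_of_mem_edgeSet' he
  set V := h.finite_vertexSet.toFinset with hVdef
  set F := hE.toFinset
  let A : Set α → Finset α := fun e => {v ∈ V | v ∈ e}
  have hAe : ∀ e ∈ F, (A e : Set α) = e := by
    intro e he
    have hs := H.subset_vertexSet_of_mem_edgeSet' (hE.mem_toFinset.1 he)
    ext v
    simpa [A, hVdef] using fun hv => hs hv
  have hAk : ∀ e ∈ F, #(A e) = k := by
    intro e he
    rw [← Set.ncard_coe_finset, hAe e he, h.uniform e (hE.mem_toFinset.1 he)]
  have hAV : ∀ e ∈ F, A e ⊆ V := fun e _ => filter_subset _ _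
  obtain ⟨S, hSV, hS⟩ := exists_subset_card_add_sum_mul_pow_le (δ := δ) V F A hp0 hp1
    fun _ => 2 / δ
  obtain ⟨T, hTV, hT, hTcard⟩ := exists_superset_two_le_card_inter hAV
    (fun e he => (hAk e he).symm ▸ hk) hSV
  have hTT : H.IsTotalTransversal (T : Set α) := by
    refine ⟨⟨fun v hv => h.finite_vertexSet.mem_toFinset.1 (hTV hv), fun e he => ?_⟩,
      fun x hx => ?_⟩
    · have he' : e ∈ F := hE.mem_toFinset.2 he
      obtain ⟨v, hv⟩ := card_pos.1 (zero_lt_two.trans_le (hT e he'))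
      exact ⟨v, hAe e he' ▸ mem_coe.2 (mem_inter.1 hv).1, (mem_inter.1 hv).2⟩
    · have hi := h.no_isolated_vertex x (h.finite_vertexSet.mem_toFinset.1 (hTV hx))
      simp only [IsIsolated, not_forall, not_not] at hi
      obtain ⟨e, he, hxe⟩ := hi
      have he' : e ∈ F := hE.mem_toFinset.2 he
      obtain ⟨y, hy, hyx⟩ := exists_mem_ne (one_lt_two.trans_le (hT e he')) x
      exact ⟨y, (mem_inter.1 hy).2, hyx, e, he, hxe, hAe e he' ▸ mem_coe.2 (mem_inter.1 hy).1⟩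
  have hnum' : H.totalTransversalNumber ≤ #T :=
    Nat.sInf_le ⟨_, hTT, Set.ncard_coe_finset T⟩
  have hnum : (H.totalTransversalNumber : ℝ) ≤ #T := by exact_mod_cast hnum'
  -- `δ ^ j / δ` is at least the indicator function of `j ≤ 1`.
  have hbad : (2 * #{e ∈ F | #(A e ∩ S) ≤ 1} : ℝ) ≤ ∑ e ∈ F, 2 / δ * δ ^ #(A e ∩ S) := by
    rw [card_filter, mul_comm]
    push_cast
    rw [sum_mul]
    refine sum_le_sum fun e _ => ?_
    split_ifs with hj
    · have : δ ^ 1 ≤ δ ^ #(A e ∩ S) := pow_le_pow_of_le_one hδ0.le hδ1 hj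
      rw [div_mul_eq_mul_div, le_div_iff₀ hδ0]
      linarith
    · simp only [zero_mul]
      positivity
  have hsum : ∑ e ∈ F, 2 / δ * (1 - p + p * δ) ^ #(A e ∩ V) =
      2 / δ * (1 - p + p * δ) ^ k * #F := by
    rw [sum_congr rfl fun e he => by rw [inter_eq_left.2 (hAV e he), hAk e he], sum_const,
      nsmul_eq_mul, mul_comm]
  rw [hsum] at hS
  rw [Set.ncard_eq_toFinset_card _ h.finite_vertexSet, Set.ncard_eq_toFinset_card _ hE]
  have : (#T : ℝ) ≤ #S + 2 * #{e ∈ F | #(A e ∩ S) ≤ 1} := by exact_mod_cast hTcard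
  linarith

/-- Here the vertices are picked with probability `log k / ((1 - δ) * k)`, which makes the expected
number of vertices added afterwards at most `2 / (δ * k)` per edge. -/
theorem eventually_totalTransversalConst_le {δ : ℝ} (hδ0 : 0 < δ) (hδ1 : δ < 1) :
    ∀ᶠ k : ℕ in atTop,
      totalTransversalConst k ≤ 1 / (1 - δ) * (Real.log (k : ℝ) / (k : ℝ)) := by
  have hlog : Tendsto (fun k : ℕ => Real.log (k : ℝ)) atTop atTop :=
    Real.tendsto_log_atTop.comp tendsto_natCast_atTop_atTop
  have hδ : 0 < 1 - δ := sub_pos.2 hδ1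
  have hsmall : ∀ᶠ k : ℕ in atTop, Real.log (k : ℝ) ≤ (1 - δ) * k := by
    filter_upwards [tendsto_natCast_atTop_atTop.eventually
      (Real.isLittleO_log_id_atTop.bound hδ)] with k hk
    simpa using (le_abs_self _).trans hk
  filter_upwards [hlog.eventually_ge_atTop (2 / δ), hsmall, eventually_ge_atTop 2]
    with k hL hLk hk
  have hk0 : (0 : ℝ) < k := by exact_mod_cast zero_lt_two.trans_le hk
  have hL0 : 0 < Real.log (k : ℝ) := lt_of_lt_of_le (by positivity) hL
  set p : ℝ := 1 / (1 - δ) * (Real.log (k : ℝ) / (k : ℝ)) with hp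
  have hp0 : 0 ≤ p := by positivity
  have hp1 : p ≤ 1 := by
    rw [hp, one_div_mul_eq_div, div_div, div_le_one (by positivity)]
    linarith
  have hpow : (1 - p + p * δ) ^ k ≤ 1 / k := by
    have h1 : 1 - p + p * δ ≤ Real.exp (-(p * (1 - δ))) := by
      have := Real.add_one_le_exp (-(p * (1 - δ)))
      linarith
    have h0 : 0 ≤ 1 - p + p * δ := by
      have : 0 ≤ p * δ := by positivity
      linarith
    calc (1 - p + p * δ) ^ k ≤ Real.exp (-(p * (1 - δ))) ^ k := pow_le_pow_left₀ h0 h1 k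
      _ = Real.exp (-Real.log k) := by
        rw [← Real.exp_nat_mul, hp]
        congr 1
        field_simp
      _ = 1 / k := by rw [Real.exp_neg, Real.exp_log hk0, one_div]
  have hedge : 2 / δ * (1 - p + p * δ) ^ k ≤ p := by
    calc 2 / δ * (1 - p + p * δ) ^ k ≤ Real.log k * (1 / k) :=
          mul_le_mul hL hpow (pow_nonneg (by nlinarith [mul_nonneg hp0 hδ0.le]) k) hL0.le
      _ = 1 * (Real.log k / k) := by ring
      _ ≤ p := by
        refine mul_le_mul_of_nonneg_right ?_ (by positivity)
        rw [le_div_iff₀ hδ]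
        linarith
  refine csSup_le (nonempty_totalTransversalRatios hk) ?_
  rintro r ⟨α, H, h, hne, rfl⟩
  have hn : (0 : ℝ) < H.vertexSet.ncard := by
    exact_mod_cast (Set.ncard_pos h.finite_vertexSet).2 hne
  rw [div_le_iff₀ (by positivity)]
  have := h.totalTransversalNumber_le hk hp0 hp1 hδ0 hδ1.le
  have := mul_le_mul_of_nonneg_right hedge (Nat.cast_nonneg (α := ℝ) H.edgeSet.ncard)
  linarith

end Hypergraph

/-! ### Lower bound: families of sets without small transversals -/

/-- Greedy choice by double counting: if every `a ∈ A` is related to at least a proportion `q` of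
`B`, then some `s` elements of `B` leave at most a proportion `(1 - q) ^ s` of `A` unrelated to all
of them. -/
theorem exists_card_le_forall_card_le_of_forall_not {α β : Type*} (A : Finset α) {B : Finset β}
    (hB : B.Nonempty) (r : α → β → Prop) [∀ a b, Decidable (r a b)] {q : ℝ} (hq1 : q ≤ 1)
    (hq : ∀ a ∈ A, q * #B ≤ #{b ∈ B | r a b}) (s : ℕ) :
    ∃ S ⊆ B, #S ≤ s ∧ ∀ C ⊆ A, (∀ a ∈ C, ∀ b ∈ S, ¬ r a b) →
      (#C : ℝ) ≤ (1 - q) ^ s * #A := by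
  classical
  suffices h : ∃ S ⊆ B, #S ≤ s ∧ (#{a ∈ A | ∀ b ∈ S, ¬ r a b} : ℝ) ≤ (1 - q) ^ s * #A by
    obtain ⟨S, hSB, hSs, hS⟩ := h
    refine ⟨S, hSB, hSs, fun C hCA hC => le_trans ?_ hS⟩
    exact_mod_cast card_le_card fun a ha => mem_filter.2 ⟨hCA ha, hC a ha⟩
  induction s with
  | zero => exact ⟨∅, empty_subset _, by simp⟩
  | succ s ih =>
    obtain ⟨S, hSB, hSs, hS⟩ := ih
    set A' := {a ∈ A | ∀ b ∈ S, ¬ r a b} with hA'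
    obtain ⟨b, hbB, hb⟩ : ∃ b ∈ B, q * #A' ≤ #{a ∈ A' | r a b} := by
      refine exists_le_of_sum_le hB ?_
      have hcount := sum_card_bipartiteAbove_eq_sum_card_bipartiteBelow (s := A') (t := B) r
      simp only [bipartiteAbove, bipartiteBelow] at hcount
      calc ∑ _b ∈ B, q * (#A' : ℝ) = ∑ _a ∈ A', q * (#B : ℝ) := by
            simp only [sum_const, nsmul_eq_mul]
            ring
        _ ≤ ∑ a ∈ A', (#{b ∈ B | r a b} : ℝ) :=
            sum_le_sum fun a ha => hq a (mem_filter.1 ha).1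
        _ = ∑ b ∈ B, (#{a ∈ A' | r a b} : ℝ) := by exact_mod_cast hcount
    refine ⟨insert b S, insert_subset hbB hSB, (card_insert_le _ _).trans (by omega), ?_⟩
    have hsplit : #{a ∈ A' | r a b} + #{a ∈ A' | ¬ r a b} = #A' :=
      card_filter_add_card_filter_not _
    have hins : ({a ∈ A | ∀ c ∈ insert b S, ¬ r a c} : Finset α) = {a ∈ A' | ¬ r a b} := by
      ext a
      simp only [hA', mem_filter, forall_mem_insert]
      tauto
    rw [hins]
    have hsplit' : (#{a ∈ A' | r a b} : ℝ) + #{a ∈ A' | ¬ r a b} = #A' := by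
      exact_mod_cast hsplit
    calc (#{a ∈ A' | ¬ r a b} : ℝ) ≤ (1 - q) * #A' := by linarith
      _ ≤ (1 - q) * ((1 - q) ^ s * #A) := mul_le_mul_of_nonneg_left hS (sub_nonneg.2 hq1)
      _ = (1 - q) ^ (s + 1) * #A := by ring

/-- The union bound for `s` random `k`-subsets of an `n`-set: `q` is a lower bound for the
probability that a `k`-set is disjoint from a given `t`-set. -/
theorem exists_family_forall_lt_card_of_meets {n k t s : ℕ} (hkn : k ≤ n) (htn : t ≤ n) {q : ℝ}
    (hq1 : q ≤ 1) (hq : q * n.choose k ≤ (n - t).choose k) (h : (1 - q) ^ s * n.choose t < 1) :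
    ∃ E : Finset (Finset (Fin n)), #E ≤ s ∧ (∀ e ∈ E, #e = k) ∧
      ∀ T : Finset (Fin n), (∀ e ∈ E, (e ∩ T).Nonempty) → t < #T := by
  obtain ⟨E, hEB, hEs, hE⟩ := exists_card_le_forall_card_le_of_forall_not
    (powersetCard t (univ : Finset (Fin n))) (B := powersetCard k (univ : Finset (Fin n)))
    (powersetCard_nonempty.2 (by simpa using hkn)) (fun T e => Disjoint e T) hq1
    (fun T hT => by
      have hdis : ({e ∈ powersetCard k (univ : Finset (Fin n)) | Disjoint e T}) =
          powersetCard k Tᶜ := by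
        ext e
        simp [mem_powersetCard, subset_compl_iff_disjoint_right, and_comm]
      rw [hdis, card_powersetCard, card_powersetCard, card_compl, (mem_powersetCard.1 hT).2]
      simpa using hq) s
  refine ⟨E, hEs, fun e he => (mem_powersetCard.1 (hEB he)).2, fun T hT => ?_⟩
  by_contra! hle
  obtain ⟨T', hTT', -, hT'⟩ := exists_subsuperset_card_eq (subset_univ T) hle (by simpa using htn)
  have hone := hE {T'} (by simpa [mem_powersetCard] using hT') fun U hU e he => by
    rw [mem_singleton.1 hU, not_disjoint_iff_nonempty_inter]
    exact (hT e he).mono (inter_subset_inter_left hTT')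
  rw [card_powersetCard, card_univ, Fintype.card_fin, card_singleton, Nat.cast_one] at hone
  exact absurd h hone.not_gt

theorem one_sub_div_pow_mul_choose_le {n k t : ℕ} (h : t + k < n) :
    (1 - (t : ℝ) / (n - k)) ^ k * n.choose k ≤ (n - t).choose k := by
  have hnk : (0 : ℝ) < n - k := by
    rw [sub_pos]
    exact_mod_cast (by omega : k < n)
  have htnk : (t : ℝ) ≤ n - k := by
    rw [le_sub_iff_add_le]
    exact_mod_cast h.le
  have hdesc : (1 - (t : ℝ) / (n - k)) ^ k * n.descFactorial k ≤ (n - t).descFactorial k := by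
    rw [Nat.descFactorial_eq_prod_range, Nat.descFactorial_eq_prod_range]
    push_cast
    rw [show (1 - (t : ℝ) / (n - k)) ^ k = ∏ _i ∈ range k, (1 - (t : ℝ) / (n - k)) by simp,
      ← prod_mul_distrib]
    refine prod_le_prod (fun i _ => mul_nonneg ?_ (Nat.cast_nonneg _)) fun i hi => ?_
    · rw [sub_nonneg, div_le_one hnk]
      exact htnk
    · have hi := mem_range.1 hi
      have hik : (i : ℝ) ≤ k := by exact_mod_cast hi.le
      rw [Nat.cast_sub (by omega), Nat.cast_sub (by omega), Nat.cast_sub (by omega)]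
      have : (t : ℝ) ≤ t / (n - k) * (n - i) := by
        rw [div_mul_eq_mul_div, le_div_iff₀ hnk]
        exact mul_le_mul_of_nonneg_left (by linarith) (Nat.cast_nonneg _)
      linarith
  rw [Nat.descFactorial_eq_factorial_mul_choose, Nat.descFactorial_eq_factorial_mul_choose] at hdesc
  push_cast at hdesc
  have hk : (0 : ℝ) < k.factorial := by exact_mod_cast k.factorial_pos
  refine le_of_mul_le_mul_left ?_ hk
  linarith

theorem exists_ne_card_eq_inter_nonempty {α : Type*} [DecidableEq α] {e : Finset α} (he : 2 ≤ #e)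
    {b : α} (hb : b ∉ e) : ∃ f : Finset α, #f = #e ∧ f ≠ e ∧ (e ∩ f).Nonempty := by
  obtain ⟨a, ha, c, hc, hac⟩ := one_lt_card.1 he
  refine ⟨insert b (e.erase a), ?_, fun h => hb (h ▸ mem_insert_self _ _), c, ?_⟩
  · rw [card_insert_of_notMem fun h => hb (mem_of_mem_erase h), card_erase_add_one ha]
  · exact mem_inter.2 ⟨hc, mem_insert_of_mem (mem_erase.2 ⟨hac.symm, hc⟩)⟩

namespace Hypergraph

/-- The members of `E` become the edges of a hypergraph of the class once each of them is given a
companion edge that meets it; this at most doubles the number of edges. -/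
theorem div_le_totalTransversalConst_of_family {n k t s : ℕ} (hk : 2 ≤ k) (hkn : k < n)
    (E : Finset (Finset (Fin n))) (hEs : #E ≤ s) (hEk : ∀ e ∈ E, #e = k)
    (hE : ∀ T : Finset (Fin n), (∀ e ∈ E, (e ∩ T).Nonempty) → t < #T) :
    ((t : ℝ) + 1) / (n + 2 * s) ≤ totalTransversalConst k := by
  classical
  have hcomp : ∀ e ∈ E, ∃ f : Finset (Fin n), #f = k ∧ f ≠ e ∧ (e ∩ f).Nonempty := by
    intro e he
    obtain ⟨b, -, hb⟩ := exists_mem_notMem_of_card_lt_card (s := e) (t := univ)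
      (by rw [hEk e he, card_univ, Fintype.card_fin]; exact hkn)
    have := exists_ne_card_eq_inter_nonempty (by rw [hEk e he]; exact hk) hb
    rwa [hEk e he] at this
  choose! c hck hcne hcint using hcomp
  set G : Finset (Finset (Fin n)) := E ∪ E.image c
  have hGk : ∀ e ∈ G, #e = k := by
    intro e he
    rcases mem_union.1 he with he | he
    · exact hEk e he
    · obtain ⟨d, hd, rfl⟩ := mem_image.1 he
      exact hck d hd
  let H : Hypergraph (Fin n) :=
    { vertexSet := ⋃ e ∈ G, (e : Set (Fin n))
      edgeSet := (fun e : Finset (Fin n) => (e : Set (Fin n))) '' G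
      subset_vertexSet_of_mem_edgeSet' := by
        rintro _ ⟨e, he, rfl⟩
        exact Set.subset_biUnion_of_mem (u := fun e : Finset (Fin n) => (e : Set (Fin n))) he }
  have hH : H.IsInClass k := by
    refine ⟨Set.toFinite _, ?_, ?_, ?_⟩
    · rintro _ ⟨e, he, rfl⟩
      rw [Set.ncard_coe_finset, hGk e he]
    · intro x hx hiso
      obtain ⟨e, he, hxe⟩ := Set.mem_iUnion₂.1 hx
      exact hiso e ⟨e, he, rfl⟩ hxe
    · rintro _ ⟨e, he, rfl⟩
      rcases mem_union.1 he with he | he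
      · refine ⟨c e, ⟨c e, mem_union_right _ (mem_image_of_mem c he), rfl⟩,
          fun h => hcne e he (coe_injective h), ?_⟩
        change ((e : Set (Fin n)) ∩ (c e : Set (Fin n))).Nonempty
        exact_mod_cast hcint e he
      · obtain ⟨d, hd, rfl⟩ := mem_image.1 he
        refine ⟨d, ⟨d, mem_union_left _ hd, rfl⟩, fun h => hcne d hd (coe_injective h).symm, ?_⟩
        rw [Set.inter_comm]
        change ((d : Set (Fin n)) ∩ (c d : Set (Fin n))).Nonempty
        exact_mod_cast hcint d hd
  have hne : H.vertexSet.Nonempty := by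
    obtain ⟨e, he⟩ : E.Nonempty := by
      by_contra hemp
      rw [not_nonempty_iff_eq_empty] at hemp
      simpa using hE ∅ (by simp [hemp])
    obtain ⟨x, hx⟩ := card_pos.1 (zero_lt_two.trans_le (hk.trans_eq (hEk e he).symm))
    exact ⟨x, Set.mem_iUnion₂.2 ⟨e, mem_union_left _ he, hx⟩⟩
  have hnum : t + 1 ≤ H.totalTransversalNumber := by
    obtain ⟨T, hT, hTn⟩ : H.totalTransversalNumber ∈
        {m : ℕ | ∃ T : Set (Fin n), H.IsTotalTransversal T ∧ T.ncard = m} :=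
      Nat.sInf_mem ⟨_, _, hH.isTotalTransversal_vertexSet hk, rfl⟩
    rw [← hTn, Set.ncard_eq_toFinset_card']
    refine hE _ fun e he => ?_
    obtain ⟨x, hxe, hxT⟩ := hT.1.2 e ⟨e, mem_union_left _ he, rfl⟩
    exact ⟨x, mem_inter.2 ⟨hxe, Set.mem_toFinset.2 hxT⟩⟩
  have hn : H.vertexSet.ncard ≤ n := by
    simpa using Set.ncard_le_card H.vertexSet
  have hm : H.edgeSet.ncard ≤ 2 * s := by
    have h1 : H.edgeSet.ncard ≤ #G := by
      rw [← Set.ncard_coe_finset]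
      exact Set.ncard_image_le (Set.toFinite _)
    have h2 : #G ≤ #E + #E := (card_union_le _ _).trans (Nat.add_le_add_left card_image_le _)
    omega
  have hV : 0 < H.vertexSet.ncard := (Set.ncard_pos (Set.toFinite _)).2 hne
  have hn' : (H.vertexSet.ncard : ℝ) ≤ n := by exact_mod_cast hn
  have hm' : (H.edgeSet.ncard : ℝ) ≤ 2 * s := by exact_mod_cast hm
  have hV' : (0 : ℝ) < H.vertexSet.ncard := by exact_mod_cast hV
  have hnum' : (t : ℝ) + 1 ≤ H.totalTransversalNumber := by exact_mod_cast hnum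
  calc ((t : ℝ) + 1) / (n + 2 * s)
      ≤ H.totalTransversalNumber / (H.vertexSet.ncard + H.edgeSet.ncard) := by
        gcongr
    _ ≤ totalTransversalConst k :=
        le_csSup (bddAbove_totalTransversalRatios hk) ⟨Fin n, H, hH, hne, rfl⟩

/-! ### Lower bound: choice of the parameters -/

/-- The witnesses are `k` sets of size `k` on about `k * log k` vertices, none of whose transversals
has size `(1 - ε) * (log k) ^ 2` or less. -/
theorem eventually_le_totalTransversalConst {ε : ℝ} (hε0 : 0 < ε) (hε1 : ε < 1) :
    ∀ᶠ k : ℕ in atTop,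
      (1 - ε) ^ 2 * (Real.log (k : ℝ) / (k : ℝ)) ≤ totalTransversalConst k := by
  have hlog : Tendsto (fun k : ℕ => Real.log (k : ℝ)) atTop atTop :=
    Real.tendsto_log_atTop.comp tendsto_natCast_atTop_atTop
  have hcube : ∀ᶠ x : ℝ in atTop, 2 * x ^ 3 < Real.exp (ε / 2 * x) := by
    filter_upwards [(isLittleO_pow_exp_pos_mul_atTop 3 (half_pos hε0)).bound
      (by norm_num : (0 : ℝ) < 1 / 4)] with x hx
    have hexp := Real.exp_pos (ε / 2 * x)
    rw [Real.norm_eq_abs, Real.norm_eq_abs, abs_of_pos hexp] at hx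
    linarith [le_abs_self (x ^ 3)]
  have hsq : ∀ᶠ x : ℝ in atTop, x ^ 2 ≤ Real.exp x := by
    filter_upwards [(isLittleO_pow_exp_pos_mul_atTop 2 one_pos).bound one_pos] with x hx
    simpa using hx
  filter_upwards [hlog.eventually hcube, hlog.eventually hsq,
    hlog.eventually_ge_atTop (4 / ε), eventually_ge_atTop 2] with k hcube hsq hLε hk
  have hk0 : (0 : ℝ) < k := by exact_mod_cast zero_lt_two.trans_le hk
  have hk1 : (1 : ℝ) ≤ k := by exact_mod_cast one_le_two.trans hk
  rw [Real.exp_log hk0] at hsq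
  set L := Real.log (k : ℝ) with hL
  have hεL : 4 ≤ ε * L := by
    rw [div_le_iff₀ hε0] at hLε
    linarith
  have hL4 : 4 ≤ L := hεL.trans (by nlinarith)
  have hL0 : 0 < L := by linarith
  have hkL : (k : ℝ) * 4 ≤ k * L := mul_le_mul_of_nonneg_left hL4 hk0.le
  set n := ⌈(k : ℝ) * L⌉₊
  set t := ⌊(1 - ε) * L ^ 2⌋₊
  have hn1 : (k : ℝ) * L ≤ n := Nat.le_ceil _
  have hn2 : (n : ℝ) ≤ k * L + 1 := (Nat.ceil_lt_add_one (by positivity)).le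
  have ht1 : (t : ℝ) ≤ (1 - ε) * L ^ 2 :=
    Nat.floor_le (mul_nonneg (by linarith) (sq_nonneg L))
  have ht2 : (1 - ε) * L ^ 2 ≤ t + 1 := (Nat.lt_floor_add_one _).le
  have htL : (t : ℝ) ≤ L ^ 2 := ht1.trans (by nlinarith [sq_nonneg L])
  have htkn : (t : ℝ) + k < n := by linarith
  have htkn' : t + k < n := by exact_mod_cast htkn
  have hn0 : (0 : ℝ) < n := by linarith
  have hlogn : Real.log n ≤ 2 * L := by
    have : (n : ℝ) ≤ (k : ℝ) ^ 2 := by nlinarith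
    calc Real.log n ≤ Real.log ((k : ℝ) ^ 2) := Real.log_le_log hn0 this
      _ = 2 * L := by rw [Real.log_pow, ← hL]; norm_num
  have hd : (0 : ℝ) < n - k := by linarith [Nat.cast_nonneg (α := ℝ) t]
  have hx0 : 0 ≤ (t : ℝ) / (n - k) := by positivity
  have hx1 : 0 < 1 - (t : ℝ) / (n - k) := by
    rw [sub_pos, div_lt_one hd]
    linarith
  set q := (1 - (t : ℝ) / (n - k)) ^ k with hq
  have hq1 : q ≤ 1 := pow_le_one₀ hx1.le (by linarith)
  -- A `k`-set misses a `t`-set with probability at least `k ^ (-(1 - ε / 2))`.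
  have hqexp : Real.exp (-(1 - ε / 2) * L) ≤ q := by
    rw [hq, ← Real.exp_log hx1, ← Real.exp_nat_mul, Real.exp_le_exp]
    have hlow := Real.one_sub_inv_le_log_of_pos hx1
    have hinv : 1 - (1 - (t : ℝ) / (n - k))⁻¹ = -(t / (n - k - t)) := by
      have hne : (n : ℝ) - k ≠ 0 := hd.ne'
      have hne' : (n : ℝ) - k - t ≠ 0 := by linarith
      rw [one_sub_div hne, inv_div]
      field_simp
      ring
    rw [hinv] at hlow
    have hmain : (k : ℝ) * (t / (n - k - t)) ≤ (1 - ε / 2) * L := by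
      rw [mul_div_assoc', div_le_iff₀ (by linarith)]
      have h1 : (k : ℝ) * t ≤ k * ((1 - ε) * L ^ 2) := mul_le_mul_of_nonneg_left ht1 hk0.le
      have h2 : (1 - ε / 2) * L * (k * L - k - k) ≤ (1 - ε / 2) * L * (n - k - t) :=
        mul_le_mul_of_nonneg_left (by linarith) (mul_nonneg (by linarith) hL0.le)
      have h3 : 0 ≤ k * L * ((1 - ε / 2) * (L - 2) - (1 - ε) * L) :=
        mul_nonneg (by positivity) (by linarith)
      linarith
    have := mul_le_mul_of_nonneg_left hlow hk0.le
    linarith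
  have hqk : Real.exp (ε / 2 * L) ≤ q * k := by
    calc Real.exp (ε / 2 * L) = Real.exp (-(1 - ε / 2) * L) * Real.exp L := by
          rw [← Real.exp_add]
          congr 1
          ring
      _ = Real.exp (-(1 - ε / 2) * L) * k := by rw [hL, Real.exp_log hk0]
      _ ≤ q * k := mul_le_mul_of_nonneg_right hqexp hk0.le
  have hunion : (1 - q) ^ k * n.choose t < 1 := by
    have h1 : (1 - q) ^ k ≤ Real.exp (-(q * k)) := by
      calc (1 - q) ^ k ≤ Real.exp (-q) ^ k :=
            pow_le_pow_left₀ (by linarith) (Real.one_sub_le_exp_neg q) k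
        _ = Real.exp (-(q * k)) := by rw [← Real.exp_nat_mul]; congr 1; ring
    have h2 : (n.choose t : ℝ) ≤ Real.exp (t * Real.log n) := by
      rw [Real.exp_nat_mul, Real.exp_log hn0]
      exact_mod_cast Nat.choose_le_pow n t
    have h3 : (t : ℝ) * Real.log n ≤ L ^ 2 * (2 * L) :=
      mul_le_mul htL hlogn (Real.log_natCast_nonneg n) (sq_nonneg L)
    calc (1 - q) ^ k * (n.choose t : ℝ)
        ≤ Real.exp (-(q * k)) * Real.exp (t * Real.log n) := by gcongr
      _ = Real.exp (-(q * k) + t * Real.log n) := (Real.exp_add _ _).symm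
      _ < 1 := by
        rw [Real.exp_lt_one_iff]
        linarith
  obtain ⟨E, hEs, hEk, hE⟩ := exists_family_forall_lt_card_of_meets (by omega) (by omega) hq1
    (one_sub_div_pow_mul_choose_le htkn') hunion
  refine le_trans ?_ (div_le_totalTransversalConst_of_family hk (by omega) E hEs hEk hE)
  calc (1 - ε) ^ 2 * (L / k) ≤ (1 - ε) * L ^ 2 / (k * (L + 3)) := by
        rw [← mul_div_assoc, div_le_div_iff₀ hk0 (by positivity)]
        have : 0 ≤ (1 - ε) * L * k * (L - (1 - ε) * (L + 3)) :=
          mul_nonneg (mul_nonneg (mul_nonneg (by linarith) hL0.le) hk0.le) (by linarith)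
        linarith
    _ ≤ ((t : ℝ) + 1) / (n + 2 * k) :=
        div_le_div₀ (by positivity) ht2 (by positivity) (by linarith)

/-! ### The limit -/

theorem tendsto_totalTransversalConst_div :
    Tendsto (fun k : ℕ => totalTransversalConst k / (Real.log (k : ℝ) / (k : ℝ))) atTop (𝓝 1) := by
  have hpos : ∀ᶠ k : ℕ in atTop, 0 < Real.log (k : ℝ) / (k : ℝ) := by
    filter_upwards [eventually_ge_atTop 2] with k hk
    have hk1 : (1 : ℝ) < k := by exact_mod_cast hk
    have := Real.log_pos hk1
    positivity
  have hsub : Tendsto (fun x : ℝ => 1 - x) (𝓝[>] 0) (𝓝 1) := by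
    have : Tendsto (fun x : ℝ => 1 - x) (𝓝 0) (𝓝 (1 - 0)) :=
      tendsto_const_nhds.sub tendsto_id
    simpa using this.mono_left nhdsWithin_le_nhds
  have hIoo : ∀ᶠ x : ℝ in 𝓝[>] 0, x ∈ Set.Ioo (0 : ℝ) 1 := Ioo_mem_nhdsGT one_pos
  rw [tendsto_order]
  constructor
  · intro a ha
    have hlim : Tendsto (fun x : ℝ => (1 - x) ^ 2) (𝓝[>] 0) (𝓝 1) := by simpa using hsub.pow 2
    obtain ⟨ε, hε, hεa⟩ := (hIoo.and (hlim.eventually_const_lt ha)).exists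
    filter_upwards [hpos, eventually_le_totalTransversalConst hε.1 hε.2] with k hk hle
    exact hεa.trans_le ((le_div_iff₀ hk).2 hle)
  · intro a ha
    have hlim : Tendsto (fun x : ℝ => 1 / (1 - x)) (𝓝[>] 0) (𝓝 1) := by
      simpa using hsub.inv₀ one_ne_zero
    obtain ⟨δ, hδ, hδa⟩ := (hIoo.and (hlim.eventually_lt_const ha)).exists
    filter_upwards [hpos, eventually_totalTransversalConst_le hδ.1 hδ.2] with k hk hle
    exact ((div_le_iff₀ hk).2 hle).trans_lt hδa

end Hypergraph

theorem theorem6 :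
    ∃ ε : ℕ → ℝ, Filter.Tendsto ε Filter.atTop (nhds 0) ∧
      ∀ᶠ k : ℕ in Filter.atTop,
        Hypergraph.totalTransversalConst k = (1 + ε k) * (Real.log (k : ℝ) / (k : ℝ)) := by
  refine ⟨fun k => Hypergraph.totalTransversalConst k / (Real.log (k : ℝ) / (k : ℝ)) - 1, ?_, ?_⟩
  · simpa using Hypergraph.tendsto_totalTransversalConst_div.sub_const 1
  · filter_upwards [eventually_ge_atTop 2] with k hk
    have hk1 : (1 : ℝ) < k := by exact_mod_cast hk
    have := Real.log_pos hk1
    rw [add_sub_cancel, div_mul_cancel₀ _ (by positivity)]
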